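/- A weighted graph is a finite directed graph $G=(V,E)$ with $E\subseteq V\times\Gamma\times V$, where the set of edge labels is $\Gamma=\{\mathsf{succ}\}\cup(\{<,\leq\}\times\mathbb Z)$. Let $\preceq$ be the reflexive-transitive closure of the relation given by the $\mathsf{succ}$-edges. $G$ is realizable if there is a map $\mathsf{ts}\colon V\to\mathbb R$ such that $\mathsf{ts}(v)-\mathsf{ts}(u)\mathrel{\triangleleft}\alpha$ for every edge $(u,\triangleleft,\alpha,v)\in E$ with $\triangleleft\in\{<,\leq\}$, and $\mathsf{ts}(u)\leq\mathsf{ts}(v)$ whenever $u\preceq v$. $G$ is $M$ weight-bounded if every weight $\alpha$ occurring on an edge satisfies $-(M-1)\leq\alpha\leq M-1$. $G$ is linear if its $\mathsf{succ}$-edges are the successor relation of a total order on $V$; $G$ is covered by two chains if its $\mathsf{succ}$-edges are the immediate-successor (covering) relation of a partial order on $V$ for which $V$ is the union of two chains. MSO denotes monadic second-order logic over weighted graphs: quantification over vertices and over sets of vertices, equality, membership, and for each $\gamma\in\Gamma$ a binary predicate for the edges labelled $\gamma$. A property $P$ is MSO-definable on a class $\mathcal C$ of weighted graphs if there is an MSO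 sentence $\varphi$ such that $G\models\varphi\iff P(G)$ for all $G\in\mathcal C$. Theorem. Without the linear order, realizability is not MSO-definable: it is not MSO-definable on the class of all weighted graphs. This already holds for graphs with a bounded set of weights that are covered by two chains: for every $M\geq 2$, realizability is not MSO-definable on the class of $M$ weight-bounded, non-linear weighted graphs that are covered by two chains. -/

import Mathlib

/-- A finite graph whose nodes carry sets of labels from `A` and whose edges carry labels from
`B`: `edge γ u v` says that `(u, γ, v)` is an edge. -/
structure LabeledGraph (A B : Type) where
  V : Type
  finite : Finite V
  label : V → Set A
  edge : B → V → V → Prop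

/-- Formulas of monadic second-order logic over `(A, B)`-labeled graphs, with free first-order
variables `0, …, n - 1` (ranging over vertices) and free set variables `0, …, m - 1` (ranging
over sets of vertices). Variables are de Bruijn indices: a quantifier binds variable `0` of its
body and shifts the other variables of its sort by one. The remaining connectives and the
universal quantifiers are the usual abbreviations. -/
inductive MSOFormula (A B : Type) : ℕ → ℕ → Type
  | label {n m : ℕ} (p : A) (x : Fin n) : MSOFormula A B n m
  | edge {n m : ℕ} (γ : B) (x y : Fin n) : MSOFormula A B n m
  | eq {n m : ℕ} (x y : Fin n) : MSOFormula A B n m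
  | mem {n m : ℕ} (x : Fin n) (X : Fin m) : MSOFormula A B n m
  | neg {n m : ℕ} (φ : MSOFormula A B n m) : MSOFormula A B n m
  | or {n m : ℕ} (φ ψ : MSOFormula A B n m) : MSOFormula A B n m
  | exVertex {n m : ℕ} (φ : MSOFormula A B (n + 1) m) : MSOFormula A B n m
  | exSet {n m : ℕ} (φ : MSOFormula A B n (m + 1)) : MSOFormula A B n m

/-- Satisfaction of a formula in `G` under a valuation `x` of the first-order variables and a
valuation `X` of the set variables. -/
def MSOFormula.Sat {A B : Type} (G : LabeledGraph A B) :
    {n m : ℕ} → MSOFormula A B n m → (Fin n → G.V) → (Fin m → Set G.V) → Prop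
  | _, _, .label p i, x, _ => p ∈ G.label (x i)
  | _, _, .edge γ i j, x, _ => G.edge γ (x i) (x j)
  | _, _, .eq i j, x, _ => x i = x j
  | _, _, .mem i j, x, X => x i ∈ X j
  | _, _, .neg φ, x, X => ¬ MSOFormula.Sat G φ x X
  | _, _, .or φ ψ, x, X => MSOFormula.Sat G φ x X ∨ MSOFormula.Sat G ψ x X
  | n, _, .exVertex φ, x, X =>
      ∃ v : G.V, MSOFormula.Sat G φ (Fin.cons v x : Fin (n + 1) → G.V) X
  | _, m, .exSet φ, x, X =>
      ∃ S : Set G.V, MSOFormula.Sat G φ x (Fin.cons S X : Fin (m + 1) → Set G.V)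

/-- An MSO sentence: a formula without free variables. -/
abbrev MSOSentence (A B : Type) : Type := MSOFormula A B 0 0

/-- `G ⊨ φ`. -/
def LabeledGraph.Models {A B : Type} (G : LabeledGraph A B) (φ : MSOSentence A B) : Prop :=
  φ.Sat G Fin.elim0 Fin.elim0

/-- The property `P` is MSO-definable on the class `C` of graphs: some MSO sentence holds in
exactly those graphs of the class that have the property. -/
def MSODefinableOn {A B : Type} (C P : LabeledGraph A B → Prop) : Prop :=
  ∃ φ : MSOSentence A B, ∀ G : LabeledGraph A B, C G → (G.Models φ ↔ P G)

/-- Edge labels of weighted graphs: the symbol `succ`, and the constraints `≤ α` and `< α` with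
`α` an integer. -/
inductive WLabel : Type
  | succ : WLabel
  | le (α : ℤ) : WLabel
  | lt (α : ℤ) : WLabel

/-- Weighted graphs have no node labels. -/
abbrev WeightedGraph : Type 1 := LabeledGraph Empty WLabel

namespace WeightedGraph

/-- The reflexive-transitive closure of the `succ`-edges. -/
def Prec (G : WeightedGraph) : G.V → G.V → Prop :=
  Relation.ReflTransGen (G.edge WLabel.succ)

/-- There are real time-stamps that satisfy all constraints `ts v - ts u ≤ α` and
`ts v - ts u < α` and are monotone along the order generated by the `succ`-edges. -/
def Realizable (G : WeightedGraph) : Prop :=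
  ∃ ts : G.V → ℝ,
    (∀ (α : ℤ) (u v : G.V), G.edge (WLabel.le α) u v → ts v - ts u ≤ (α : ℝ)) ∧
    (∀ (α : ℤ) (u v : G.V), G.edge (WLabel.lt α) u v → ts v - ts u < (α : ℝ)) ∧
    (∀ u v : G.V, G.Prec u v → ts u ≤ ts v)

/-- All weights that occur on edges lie in `{-(M - 1), …, M - 1}`. -/
def WeightBounded (M : ℕ) (G : WeightedGraph) : Prop :=
  ∀ (α : ℤ) (u v : G.V), G.edge (WLabel.le α) u v ∨ G.edge (WLabel.lt α) u v →
    -((M : ℤ) - 1) ≤ α ∧ α ≤ (M : ℤ) - 1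

/-- The `succ`-edges are the successor relation of a total order on the vertices. -/
def IsLinear (G : WeightedGraph) : Prop :=
  ∃ _ : LinearOrder G.V, ∀ u v : G.V, G.edge WLabel.succ u v ↔ u ⋖ v

/-- The `succ`-edges are the (immediate) successor relation of a partial order on the vertices
(which is then `Prec`), and two chains of this order cover all vertices. -/
def CoveredByTwoChains (G : WeightedGraph) : Prop :=
  ∃ _ : PartialOrder G.V, (∀ u v : G.V, G.edge WLabel.succ u v ↔ u ⋖ v) ∧
    ∃ S T : Set G.V, IsChain (· ≤ ·) S ∧ IsChain (· ≤ ·) T ∧ S ∪ T = Set.univ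

end WeightedGraph

/-!
The two chains measure lengths against each other. In `chainPair m n` the first chain has `m + 1`
vertices and consecutive time-stamps at distance at least `1`, the second chain has `n + 1`
vertices and consecutive time-stamps at distance at most `1`, and the span of the first chain must
not exceed that of the second. So `chainPair m n` is realizable exactly if `m ≤ n`
(`chainPair_realizable`, `not_chainPair_realizable`), although all its weights lie in `{-1, 0, 1}`.

A fixed MSO sentence `φ` cannot make this comparison, by a composition argument in the style of
Feferman and Vaught. The two chains interact only through the marked end points of the first one,
hence whether `φ` holds in `chainPair m n` depends on the first chain only through its `φ`-type
(`Sat.of_partialType_eq`). There are finitely many `φ`-types, so two chains of different lengths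
`m < n` have the same one, and then `φ` does not distinguish the realizable `chainPair m m` from
the unrealizable `chainPair n m`.
-/

/-! ### Composition of MSO types -/

/-- The disjoint union of `G` and `H` with additional edges between the two parts. An edge between
`a` in `G` and `q` in `H` depends on `a` only through its node labels: `out γ c q` puts an edge
labeled `γ` from every `c`-labeled node to `q`, and `inn γ q c` one in the opposite direction. The
node labels of `G` and `H` are forgotten. -/
abbrev LabeledGraph.glue {C D B : Type} (G : LabeledGraph C B) (H : LabeledGraph D B)
    (out : B → C → H.V → Prop) (inn : B → H.V → C → Prop) : LabeledGraph Empty B where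
  V := G.V ⊕ H.V
  finite := by
    have := G.finite
    have := H.finite
    infer_instance
  label _ := ∅
  edge γ
    | .inl a, .inl b => G.edge γ a b
    | .inl a, .inr q => ∃ c ∈ G.label a, out γ c q
    | .inr q, .inl a => ∃ c ∈ G.label a, inn γ q c
    | .inr q, .inr r => H.edge γ q r

namespace MSOFormula

/-- The space of possible `φ`-types of a `C`-labeled graph: the data about one part of a glued
graph on which the truth of `φ` depends. -/
def PartialType (C : Type) {B : Type} : {n m : ℕ} → MSOFormula Empty B n m → Type
  | _, _, .label _ _ => Unit
  | _, _, .edge _ _ _ => Prop × Set C × Set C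
  | _, _, .eq _ _ => Prop
  | _, _, .mem _ _ => Prop
  | _, _, .neg φ => PartialType C φ
  | _, _, .or φ ψ => PartialType C φ × PartialType C ψ
  | _, _, .exVertex φ => Set (PartialType C φ) × PartialType C φ
  | _, _, .exSet φ => Set (PartialType C φ)

theorem PartialType.finite (C : Type) [Finite C] {B : Type} :
    {n m : ℕ} → (φ : MSOFormula Empty B n m) → Finite (PartialType C φ)
  | _, _, .label _ _ => inferInstanceAs (Finite Unit)
  | _, _, .edge _ _ _ => inferInstanceAs (Finite (Prop × Set C × Set C))
  | _, _, .eq _ _ => inferInstanceAs (Finite Prop)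
  | _, _, .mem _ _ => inferInstanceAs (Finite Prop)
  | _, _, .neg φ => PartialType.finite C φ
  | _, _, .or φ ψ => by
    have := PartialType.finite C φ
    have := PartialType.finite C ψ
    exact inferInstanceAs (Finite (PartialType C φ × PartialType C ψ))
  | _, _, .exVertex φ => by
    have := PartialType.finite C φ
    exact inferInstanceAs (Finite (Set (PartialType C φ) × PartialType C φ))
  | _, _, .exSet φ => by
    have := PartialType.finite C φ
    exact inferInstanceAs (Finite (Set (PartialType C φ)))

/-- The `φ`-type of `G` under a valuation. A first-order variable has the value `none` if its
vertex lies in the other part of the glued graph. -/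
def partialType {C B : Type} (G : LabeledGraph C B) : {n m : ℕ} → (φ : MSOFormula Empty B n m) →
    (Fin n → Option G.V) → (Fin m → Set G.V) → PartialType C φ
  | _, _, .label _ _, _, _ => ()
  | _, _, .edge γ i j, x, _ =>
      (∃ a ∈ x i, ∃ b ∈ x j, G.edge γ a b,
        {c | ∃ a ∈ x i, c ∈ G.label a}, {c | ∃ b ∈ x j, c ∈ G.label b})
  | _, _, .eq i j, x, _ => ∃ a ∈ x i, a ∈ x j
  | _, _, .mem i j, x, X => ∃ a ∈ x i, a ∈ X j
  | _, _, .neg φ, x, X => partialType G φ x X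
  | _, _, .or φ ψ, x, X => (partialType G φ x X, partialType G ψ x X)
  | n, _, .exVertex φ, x, X =>
      (Set.range fun a : G.V => partialType G φ (Fin.cons (some a) x : Fin (n + 1) → _) X,
        partialType G φ (Fin.cons none x : Fin (n + 1) → _) X)
  | _, m, .exSet φ, x, X =>
      Set.range fun S : Set G.V => partialType G φ x (Fin.cons S X : Fin (m + 1) → _)

theorem getLeft?_comp_cons {α β : Type} {n : ℕ} (v : α ⊕ β) (x : Fin n → α ⊕ β) :
    (fun i => ((Fin.cons v x : Fin (n + 1) → α ⊕ β) i).getLeft?) =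
      (Fin.cons v.getLeft? fun i => (x i).getLeft? : Fin (n + 1) → Option α) := by
  funext i
  refine Fin.cases ?_ (fun i => ?_) i <;> simp

theorem preimage_inl_comp_cons {α β : Type} {m : ℕ} (S : Set (α ⊕ β)) (X : Fin m → Set (α ⊕ β)) :
    (fun j => Sum.inl ⁻¹' (Fin.cons S X : Fin (m + 1) → Set (α ⊕ β)) j) =
      (Fin.cons (Sum.inl ⁻¹' S) fun j => Sum.inl ⁻¹' X j : Fin (m + 1) → Set α) := by
  funext j
  refine Fin.cases ?_ (fun j => ?_) j <;> simp

/-- The composition theorem: the left part of a glued graph can be replaced by any graph of the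
same `φ`-type without affecting the truth of `φ`. The valuations have to agree on the right part,
and a first-order variable has to lie in the left part under both valuations or under none. -/
theorem Sat.of_partialType_eq {C D B : Type} {H : LabeledGraph D B}
    {out : B → C → H.V → Prop} {inn : B → H.V → C → Prop} {n m : ℕ}
    (φ : MSOFormula Empty B n m) {G G' : LabeledGraph C B}
    {x : Fin n → G.V ⊕ H.V} {x' : Fin n → G'.V ⊕ H.V}
    {X : Fin m → Set (G.V ⊕ H.V)} {X' : Fin m → Set (G'.V ⊕ H.V)}
    (hx : ∀ i, Sum.LiftRel (fun _ _ => True) Eq (x i) (x' i))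
    (hX : ∀ j, Sum.inr ⁻¹' X j = Sum.inr ⁻¹' X' j)
    (h : partialType G φ (fun i => (x i).getLeft?) (fun j => Sum.inl ⁻¹' X j) =
      partialType G' φ (fun i => (x' i).getLeft?) (fun j => Sum.inl ⁻¹' X' j))
    (hφ : φ.Sat (G.glue H out inn) x X) : φ.Sat (G'.glue H out inn) x' X' := by
  induction φ generalizing G G' with
  | label p => exact p.elim
  | edge γ i j =>
    have hi := hx i
    have hj := hx j
    obtain ⟨h₁, h₂⟩ := Prod.mk.inj h
    obtain ⟨h₂, h₃⟩ := Prod.mk.inj h₂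
    replace hφ : (G.glue H out inn).edge γ (x i) (x j) := hφ
    change (G'.glue H out inn).edge γ (x' i) (x' j)
    clear h
    beta_reduce at h₁ h₂ h₃
    generalize x i = u, x j = v, x' i = u', x' j = v' at *
    simp only [Set.ext_iff, Set.mem_ofPred_eq] at h₂ h₃
    cases hi <;> cases hj <;> simp_all
  | eq i j =>
    have hi := hx i
    have hj := hx j
    replace h : (∃ a ∈ (x i).getLeft?, a ∈ (x j).getLeft?) =
      (∃ a ∈ (x' i).getLeft?, a ∈ (x' j).getLeft?) := h
    replace hφ : x i = x j := hφ
    change x' i = x' j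
    generalize x i = u, x j = v, x' i = u', x' j = v' at *
    cases hi <;> cases hj <;> simp_all
  | mem i j =>
    have hi := hx i
    have hj := Set.ext_iff.1 (hX j)
    replace h : (∃ a ∈ (x i).getLeft?, a ∈ Sum.inl ⁻¹' X j) =
      (∃ a ∈ (x' i).getLeft?, a ∈ Sum.inl ⁻¹' X' j) := h
    replace hφ : x i ∈ X j := hφ
    change x' i ∈ X' j
    simp only [Set.mem_preimage] at hj h
    generalize x i = u, x' i = u' at *
    cases hi <;> simp_all
  | neg φ ih =>
    refine fun h' => hφ (ih (fun i => ?_) (fun j => (hX j).symm) h.symm h')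
    have hi := hx i
    generalize x i = u, x' i = u' at hi
    cases hi with
    | inl => exact .inl trivial
    | inr e => exact .inr e.symm
  | or φ ψ ihφ ihψ =>
    have h := Prod.mk.inj h
    exact hφ.imp (ihφ hx hX h.1) (ihψ hx hX h.2)
  | exVertex φ ih =>
    have h := Prod.mk.inj h
    obtain ⟨v, hv⟩ := hφ
    cases v with
    | inl a =>
      obtain ⟨a', ha'⟩ := (Set.ext_iff.1 h.1 _).1 (Set.mem_range_self a)
      refine ⟨Sum.inl a', ih (Fin.cases (.inl trivial) hx) hX ?_ hv⟩
      exact (getLeft?_comp_cons (Sum.inl a) x).symm ▸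
        (getLeft?_comp_cons (Sum.inl a') x').symm ▸ ha'.symm
    | inr q =>
      refine ⟨Sum.inr q, ih (Fin.cases (.inr rfl) hx) hX ?_ hv⟩
      exact (getLeft?_comp_cons (Sum.inr q) x).symm ▸
        (getLeft?_comp_cons (Sum.inr q) x').symm ▸ h.2
  | exSet φ ih =>
    obtain ⟨S, hS⟩ := hφ
    obtain ⟨S', hS'⟩ := (Set.ext_iff.1 h _).1 (Set.mem_range_self (Sum.inl ⁻¹' S))
    refine ⟨{v | Sum.elim (· ∈ S') (Sum.inr · ∈ S) v}, ih hx (Fin.cases rfl hX) ?_ hS⟩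
    exact (preimage_inl_comp_cons S X).symm ▸ (preimage_inl_comp_cons _ X').symm ▸ hS'.symm

end MSOFormula

/-! ### Two chains measuring each other -/

namespace WeightedGraph

/-- A chain of `n + 1` vertices whose consecutive time-stamps differ by at least `1`. The label
`false` marks its first and `true` its last vertex. -/
abbrev slowChain (n : ℕ) : LabeledGraph Bool WLabel where
  V := Fin (n + 1)
  finite := inferInstance
  label i := {c | i = bif c then Fin.last n else 0}
  edge
    | .succ, i, j => i ⋖ j
    | .le α, i, j => α = -1 ∧ j ⋖ i
    | .lt _, _, _ => False

/-- A chain of `n + 1` vertices whose consecutive time-stamps differ by at most `1`. -/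
abbrev fastChain (n : ℕ) : WeightedGraph where
  V := Fin (n + 1)
  finite := inferInstance
  label _ := ∅
  edge
    | .succ, i, j => i ⋖ j
    | .le α, i, j => α = 1 ∧ i ⋖ j
    | .lt _, _, _ => False

/-- A slow chain with `m + 1` and a fast chain with `n + 1` vertices, where edges of weight `0`
from the first slow to the first fast vertex and from the last fast to the last slow vertex
require that the fast chain spans at least as much time as the slow chain. -/
abbrev chainPair (m n : ℕ) : WeightedGraph :=
  (slowChain m).glue (fastChain n) (fun γ c q => γ = .le 0 ∧ c = false ∧ q = (0 : Fin (n + 1)))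
    (fun γ q c => γ = .le 0 ∧ c = true ∧ q = Fin.last n)

theorem chainPair_edge_succ (m n : ℕ) (u v : Fin (m + 1) ⊕ Fin (n + 1)) :
    (chainPair m n).edge .succ u v ↔ u ⋖ v := by
  rcases u with i | i <;> rcases v with j | j
  · change i ⋖ j ↔ _
    simp [CovBy, Sum.forall]
  · simp [CovBy]
  · simp [CovBy]
  · change i ⋖ j ↔ _
    simp [CovBy, Sum.forall]

theorem chainPair_coveredByTwoChains (m n : ℕ) : (chainPair m n).CoveredByTwoChains := by
  refine ⟨inferInstanceAs (PartialOrder (Fin (m + 1) ⊕ Fin (n + 1))), chainPair_edge_succ m n,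
    Set.range Sum.inl, Set.range Sum.inr, ?_, ?_, Set.range_inl_union_range_inr⟩
  · rintro _ ⟨i, rfl⟩ _ ⟨j, rfl⟩ -
    exact (le_total i j).imp Sum.inl_le_inl_iff.2 Sum.inl_le_inl_iff.2
  · rintro _ ⟨i, rfl⟩ _ ⟨j, rfl⟩ -
    exact (le_total i j).imp Sum.inr_le_inr_iff.2 Sum.inr_le_inr_iff.2

/-- A finite total order has only one element without a predecessor. -/
theorem IsLinear.eq_of_forall_not_edge {G : WeightedGraph} (hG : G.IsLinear) {a b : G.V}
    (ha : ∀ u, ¬ G.edge .succ u a) (hb : ∀ u, ¬ G.edge .succ u b) : a = b := by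
  obtain ⟨_, hsucc⟩ := hG
  have := G.finite
  by_contra hab
  rcases lt_or_gt_of_ne hab with h | h
  · obtain ⟨u, -, hu⟩ := exists_le_covBy_of_lt h
    exact hb u ((hsucc u b).2 hu)
  · obtain ⟨u, -, hu⟩ := exists_le_covBy_of_lt h
    exact ha u ((hsucc u a).2 hu)

theorem chainPair_not_isLinear (m n : ℕ) : ¬ (chainPair m n).IsLinear := fun h =>
  Sum.inl_ne_inr (h.eq_of_forall_not_edge (a := Sum.inl (0 : Fin (m + 1)))
    (b := Sum.inr (0 : Fin (n + 1)))
    (fun u hu => by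
      have := ((chainPair_edge_succ m n u _).1 hu).lt
      rcases u with i | i <;> simp at this)
    (fun u hu => by
      have := ((chainPair_edge_succ m n u _).1 hu).lt
      rcases u with i | i <;> simp at this))

theorem chainPair_weightBounded (m n : ℕ) {M : ℕ} (hM : 2 ≤ M) :
    (chainPair m n).WeightBounded M := by
  rintro α (i | i) (j | j) (h | h) <;>
    simp only [WLabel.le.injEq, reduceCtorEq, false_and, and_false, exists_false] at h
  · omega
  · obtain ⟨_, _, h, _⟩ := h
    omega
  · obtain ⟨_, _, h, _⟩ := h
    omega
  · omega

theorem val_add_one_of_covBy {n : ℕ} {i j : Fin n} (h : i ⋖ j) : (i : ℕ) + 1 = j :=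
  Nat.covBy_iff_add_one_eq.1 (Fin.covBy_iff.1 h)

/-- The time-stamps that increase by exactly `1` along both chains satisfy all constraints. -/
theorem chainPair_realizable {m n : ℕ} (h : m ≤ n) : (chainPair m n).Realizable := by
  let ts : Fin (m + 1) ⊕ Fin (n + 1) → ℝ := Sum.elim (fun i => (i : ℕ)) (fun j => (j : ℕ))
  have hmn : (m : ℝ) ≤ n := by exact_mod_cast h
  have hm : ∀ {i j : Fin (m + 1)}, i ⋖ j → (j : ℝ) = i + 1 := fun h => by
    exact_mod_cast (val_add_one_of_covBy h).symm
  have hn : ∀ {i j : Fin (n + 1)}, i ⋖ j → (j : ℝ) = i + 1 := fun h => by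
    exact_mod_cast (val_add_one_of_covBy h).symm
  refine ⟨ts, ?_, ?_, ?_⟩
  · rintro α (i | i) (j | j) e
    · obtain ⟨rfl, e⟩ := e
      simp [ts, hm e]
    · obtain ⟨c, hc, e, rfl, rfl⟩ := e
      obtain rfl : α = 0 := by simpa using e
      simp [ts]
    · obtain ⟨c, rfl, e, rfl, rfl⟩ := e
      obtain rfl : α = 0 := by simpa using e
      simp [ts, hmn]
    · obtain ⟨rfl, e⟩ := e
      simp [ts, hn e]
  · rintro α (i | i) (j | j) e
    · exact e.elim
    · obtain ⟨c, hc, e, -⟩ := e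
      cases e
    · obtain ⟨c, hc, e, -⟩ := e
      cases e
    · exact e.elim
  · intro u v huv
    induction huv with
    | refl => rfl
    | @tail v w _ e ih =>
      refine ih.trans ?_
      have e := ((chainPair_edge_succ m n v w).1 e).le
      rcases v with i | i <;> rcases w with j | j
      · simpa [ts] using e
      · simp at e
      · simp at e
      · simpa [ts] using e

theorem not_chainPair_realizable {m n : ℕ} (h : n < m) : ¬ (chainPair m n).Realizable := by
  rintro ⟨ts, hle, -, -⟩
  let s : Fin (m + 1) → ℝ := fun i => ts (Sum.inl i)
  let f : Fin (n + 1) → ℝ := fun i => ts (Sum.inr i)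
  have hs : ∀ i : Fin (m + 1), s 0 + (i : ℕ) ≤ s i := by
    intro i
    induction i using Fin.induction with
    | zero => simp
    | succ i ih =>
      have := hle (-1) (Sum.inl i.succ) (Sum.inl i.castSucc)
        ⟨rfl, by simp⟩
      simp only [Fin.val_castSucc, Fin.val_succ] at ih ⊢
      push_cast at this ⊢
      linarith
  have hf : ∀ i : Fin (n + 1), f i ≤ f 0 + (i : ℕ) := by
    intro i
    induction i using Fin.induction with
    | zero => simp
    | succ i ih =>
      have := hle 1 (Sum.inr i.castSucc) (Sum.inr i.succ) ⟨rfl, by simp⟩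
      simp only [Fin.val_castSucc, Fin.val_succ] at ih ⊢
      push_cast at this ⊢
      linarith
  have h₀ := hle 0 (Sum.inl (0 : Fin (m + 1))) (Sum.inr (0 : Fin (n + 1)))
    ⟨false, rfl, rfl, rfl, rfl⟩
  have h₁ := hle 0 (Sum.inr (Fin.last n)) (Sum.inl (Fin.last m)) ⟨true, rfl, rfl, rfl, rfl⟩
  have hs := hs (Fin.last m)
  have hf := hf (Fin.last n)
  have hmn : (n : ℝ) < m := by exact_mod_cast h
  simp only [Fin.val_last, Int.cast_zero] at *
  linarith

/-- By the pigeonhole principle, two slow chains of different lengths have the same `φ`-type, so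
that `φ` does not notice when the shorter one is replaced by the longer one. -/
theorem exists_lt_chainPair_models (φ : MSOSentence Empty WLabel) :
    ∃ m n : ℕ, m < n ∧ ((chainPair m m).Models φ → (chainPair n m).Models φ) := by
  have := MSOFormula.PartialType.finite Bool φ
  obtain ⟨m, n, hmn, h⟩ := Finite.exists_ne_map_eq_of_infinite
    fun n => MSOFormula.partialType (slowChain n) φ Fin.elim0 Fin.elim0
  wlog hlt : m < n generalizing m n
  · exact this n m hmn.symm h.symm (by omega)
  refine ⟨m, n, hlt, MSOFormula.Sat.of_partialType_eq φ (fun i => i.elim0) (fun j => j.elim0) ?_⟩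
  convert h using 2

theorem not_msoDefinableOn_realizable {M : ℕ} (hM : 2 ≤ M) :
    ¬ MSODefinableOn
        (fun G : WeightedGraph => G.WeightBounded M ∧ G.CoveredByTwoChains ∧ ¬ G.IsLinear)
        Realizable := by
  rintro ⟨φ, hφ⟩
  obtain ⟨m, n, hmn, h⟩ := exists_lt_chainPair_models φ
  have hC (m n : ℕ) := hφ (chainPair m n) ⟨chainPair_weightBounded m n hM,
    chainPair_coveredByTwoChains m n, chainPair_not_isLinear m n⟩
  exact not_chainPair_realizable hmn
    ((hC n m).1 (h ((hC m m).2 (chainPair_realizable le_rfl))))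

end WeightedGraph

theorem mainTheorem3 :
    ¬ MSODefinableOn (fun _ : WeightedGraph => True) WeightedGraph.Realizable ∧
    ∀ M : ℕ, 2 ≤ M →
      ¬ MSODefinableOn
          (fun G : WeightedGraph =>
            WeightedGraph.WeightBounded M G ∧ WeightedGraph.CoveredByTwoChains G ∧
              ¬ WeightedGraph.IsLinear G)
          WeightedGraph.Realizable :=
  ⟨fun ⟨φ, hφ⟩ =>
    WeightedGraph.not_msoDefinableOn_realizable le_rfl ⟨φ, fun G _ => hφ G trivial⟩,
    fun _ hM => WeightedGraph.not_msoDefinableOn_realizable hM⟩
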